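/- Let a finite, nonempty collection $\mathbf S$ of super arms (finite sets of arms) be given, together with a class of functions $\mathcal F=\{f_\vartheta:\mathbf S\to[0,C] \mid \vartheta\in\Theta\}$ indexed by a measurable space $\Theta$, with $\vartheta\mapsto f_\vartheta(s)$ measurable for every $s$. Let $\theta$ be a $\Theta$-valued random variable (its law is the prior). In each round $t=1,2,\dots$ a random nonempty set $\mathbf S_t\subseteq\mathbf S$ is presented, a super arm $\mathcal S_t\in\mathbf S_t$ is chosen, and the reward $R_t=f_\theta(\mathcal S_t)+\epsilon_t$ is observed. Write $\mathcal H_t$ for the history $(\mathbf S_1,\mathcal S_1,R_1,\dots,\mathbf S_{t-1},\mathcal S_{t-1},R_{t-1},\mathbf S_t)$. The noise satisfies $|\epsilon_t|\le 1$ almost surely and $\mathbb E[\epsilon_t\mid\mathcal H_t,\theta,\mathcal S_t]=0$. The policy is Thompson sampling $\pi^{\mathrm{TS}}$: in round $t$ it draws $\hat\theta_t$ from the posterior law of $\theta$ given $\mathcal H_t$ (conditionally independently of $\theta$ given $\mathcal H_t$) and chooses $\mathcal S_t\in\arg\max_{s\in\mathbf S_t}f_{\hat\theta_t}(s)$. Its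 Bayesian regret is $$\mathrm{Regret}(T,\pi^{\mathrm{TS}})=\sum_{t=1}^T\mathbb E\Big[\max_{s\in\mathbf S_t}f_\theta(s)-f_\theta(\mathcal S_t)\Big].$$ For $\epsilon\ge 0$, call $s\in\mathbf S$ $\epsilon$-dependent on $s_1,\dots,s_n\in\mathbf S$ if all $f,g\in\mathcal F$ with $\sqrt{\sum_{i=1}^n(f(s_i)-g(s_i))^2}\le\epsilon$ satisfy $|f(s)-g(s)|\le\epsilon$, and $\epsilon$-independent of them otherwise. Let $\dim_E(\mathcal F,\epsilon)$ be the length of the longest sequence in $\mathbf S$ such that, for some $\epsilon'\ge\epsilon$, every element is $\epsilon'$-independent of its predecessors. For $\alpha_0>0$ let $N(\mathcal F,\alpha_0,\|\cdot\|_\infty)$ be the least size of a set $\mathcal G\subseteq\mathcal F$ such that every $f\in\mathcal F$ has some $g\in\mathcal G$ with $\|f-g\|_\infty\le\alpha_0$, and put $$\beta_T^*(\mathcal F,\alpha_0,\delta)=8\ln\frac{N(\mathcal F,\alpha_0,\|\cdot\|_\infty)}{\delta}+2\alpha_0T\Big(\frac{15}{2}C+\ln\frac{2T^2}{\delta}\Big).$$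 Then for every integer $T\ge1$, every $\alpha_0>0$ and every $0<\delta\le\frac1{2T}$, $$\mathrm{Regret}(T,\pi^{\mathrm{TS}})\le 4\sqrt{\dim_E(\mathcal F,1/T)\,\beta_T^*(\mathcal F,\alpha_0,\delta)\,T}+1+\big[\dim_E(\mathcal F,1/T)+1\big]C.$$ -/

import Mathlib

open MeasureTheory ProbabilityTheory

namespace SuperArmBandit

section EluderDimension

variable {S : Type*}

/-- The action `a` is `ε`-dependent, with respect to the class `F`, on the actions
`p i`, `i ∈ I`: any two functions of `F` that are `ε`-close on those actions
(in the root of the sum of squares) differ by at most `ε` at `a`. -/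
def EpsDependent (F : Set (S → ℝ)) (ε : ℝ) (a : S) {ι : Type*} (I : Finset ι) (p : ι → S) :
    Prop :=
  ∀ f ∈ F, ∀ g ∈ F, √(∑ i ∈ I, (f (p i) - g (p i)) ^ 2) ≤ ε → |f a - g a| ≤ ε

/-- Some sequence of `n` actions and some `ε' ≥ ε` are such that every action of the sequence
is `ε'`-independent of its predecessors. -/
def HasIndependentSeq (F : Set (S → ℝ)) (ε : ℝ) (n : ℕ) : Prop :=
  ∃ s : Fin n → S, ∃ ε' : ℝ, ε ≤ ε' ∧ ∀ k, ¬ EpsDependent F ε' (s k) (Finset.Iio k) s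

/-- The `ε`-margin (eluder) dimension `dim_E(F, ε)`: the length of the longest sequence of
actions such that, for some `ε' ≥ ε`, every element is `ε'`-independent of its predecessors. -/
noncomputable def eluderDim (F : Set (S → ℝ)) (ε : ℝ) : ℕ∞ :=
  ⨆ (n : ℕ) (_ : HasIndependentSeq F ε n), (n : ℕ∞)

/-- The margin dimension is at most the number of actions. -/
theorem eluderDim_le_card [Fintype S] (F : Set (S → ℝ)) (ε : ℝ) :
    eluderDim F ε ≤ (Fintype.card S : ℕ∞) := by
  refine iSup₂_le fun n hn => ?_
  obtain ⟨s, ε', -, h⟩ := hn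
  have key : ∀ i k, i < k → s i ≠ s k := by
    intro i k hik heq
    refine h k fun f _ g _ hfg => le_trans ?_ hfg
    rw [← Real.sqrt_sq_eq_abs, ← heq]
    exact Real.sqrt_le_sqrt (Finset.single_le_sum (f := fun j => (f (s j) - g (s j)) ^ 2)
      (fun j _ => sq_nonneg _) (Finset.mem_Iio.2 hik))
  have hinj : Function.Injective s := by
    intro i k hik
    rcases lt_trichotomy i k with hlt | heq | hlt
    · exact absurd hik (key i k hlt)
    · exact heq
    · exact absurd hik.symm (key k i hlt)
  have hc := Fintype.card_le_of_injective s hinj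
  rw [Fintype.card_fin] at hc
  exact_mod_cast hc

/-- With finitely many actions the margin dimension is a genuine natural number. -/
theorem eluderDim_ne_top [Fintype S] (F : Set (S → ℝ)) (ε : ℝ) : eluderDim F ε ≠ ⊤ :=
  ne_top_of_le_ne_top (ENat.natCast_ne_top _) (eluderDim_le_card F ε)

end EluderDimension

section ConfidenceWidth

variable {S : Type*} [Fintype S]

/-- The `α₀`-covering number of `F` in the sup-norm (which is the norm of `S → ℝ`): the least
number of elements of an `α₀`-cover of `F` by elements of `F`. -/
noncomputable def supCoveringNumber (F : Set (S → ℝ)) (α₀ : ℝ) : ℕ :=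
  (Metric.coveringNumber α₀.toNNReal F).toNat

/-- For functions with values in `[0, C]` and `α₀ > 0` the covering number is finite, so that
`supCoveringNumber` is the cardinality of an actual cover. -/
theorem coveringNumber_ne_top {F : Set (S → ℝ)} {C α₀ : ℝ} (hα₀ : 0 < α₀)
    (hF : ∀ f ∈ F, ∀ s, f s ∈ Set.Icc 0 C) :
    Metric.coveringNumber α₀.toNNReal F ≠ ⊤ := by
  have hsub : F ⊆ Set.Icc (fun _ => 0) (fun _ => C) := fun f hf =>
    ⟨fun s => (hF f hf s).1, fun s => (hF f hf s).2⟩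
  have htb : TotallyBounded F := isCompact_Icc.totallyBounded.subset hsub
  obtain ⟨t, htF, htfin, hcov⟩ := Metric.totallyBounded_iff.1 htb |> fun _ =>
    totallyBounded_iff_subset.1 htb _ (Metric.dist_mem_uniformity hα₀)
  have hc : Metric.IsCover α₀.toNNReal F t := by
    intro f hf
    obtain ⟨g, hg, hfg⟩ := Set.mem_iUnion₂.1 (hcov hf)
    refine ⟨g, hg, ?_⟩
    have hd : dist f g < α₀ := hfg
    change edist f g ≤ ((α₀.toNNReal : NNReal) : ENNReal)
    rw [edist_dist]
    exact ENNReal.ofReal_le_ofReal hd.le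
  exact ne_top_of_le_ne_top (Set.encard_ne_top_iff.2 htfin)
    (hc.coveringNumber_le_encard htF)

/-- The confidence width
`β*_t(F, α₀, δ) = 8 ln (N(F, α₀, ‖·‖_∞) / δ) + 2 α₀ t (15/2 C + ln (2 t² / δ))`. -/
noncomputable def confWidth (F : Set (S → ℝ)) (C α₀ δ : ℝ) (t : ℕ) : ℝ :=
  8 * Real.log ((supCoveringNumber F α₀ : ℝ) / δ)
    + 2 * α₀ * t * (15 / 2 * C + Real.log (2 * (t : ℝ) ^ 2 / δ))

end ConfidenceWidth

section Interaction

variable {S Θ Ω : Type*}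

/-- The information available before the action of round `t` is chosen: the presented sets,
the actions and the rewards of all earlier rounds, and the set presented in round `t`.
Rounds are numbered `0, 1, 2, …`. -/
@[reducible] def history (avail : ℕ → Ω → Finset S) (act : ℕ → Ω → S) (R : ℕ → Ω → ℝ) (t : ℕ) :
    MeasurableSpace Ω :=
  (⨆ k : Fin t, (MeasurableSpace.comap (avail k) ⊤ ⊔ MeasurableSpace.comap (act k) ⊤
      ⊔ MeasurableSpace.comap (R k) (borel ℝ)))
    ⊔ MeasurableSpace.comap (avail t) ⊤

variable [MeasurableSpace Θ] [MeasurableSpace Ω]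

/-- The interaction of some policy with the environment. The parameter `θ` is random; in round
`t` a random nonempty set `avail t` of actions is presented, the action `act t` is taken from
it, and the reward `R t = f_θ(act t) + ε_t` is observed. The noise `ε_t` has values in `[-1, 1]`
and mean zero given the history, the parameter and the chosen action. -/
structure IsInteraction (μ : Measure Ω) (f : Θ → S → ℝ) (θ : Ω → Θ)
    (avail : ℕ → Ω → Finset S) (act : ℕ → Ω → S) (R : ℕ → Ω → ℝ) : Prop where
  measurable_param : Measurable θ
  measurable_avail : ∀ t, Measurable[_, ⊤] (avail t)
  measurable_act : ∀ t, Measurable[_, ⊤] (act t)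
  measurable_reward : ∀ t, Measurable (R t)
  avail_nonempty : ∀ t ω, (avail t ω).Nonempty
  act_mem : ∀ t ω, act t ω ∈ avail t ω
  noise_bounded : ∀ t, ∀ᵐ ω ∂μ, |R t ω - f (θ ω) (act t ω)| ≤ 1
  noise_centered : ∀ t,
    μ[fun ω => R t ω - f (θ ω) (act t ω) |
      history avail act R t ⊔ MeasurableSpace.comap θ inferInstance
        ⊔ MeasurableSpace.comap (act t) ⊤] =ᵐ[μ] 0

/-- Thompson (posterior) sampling: in every round a parameter `θhat t` is drawn from the
posterior distribution of `θ` given the history (by a draw that, given the history, does not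
look at `θ` itself), and the chosen action maximizes `f_{θhat t}` over the presented set. -/
structure IsThompsonSampling (μ : Measure Ω) (f : Θ → S → ℝ) (θ : Ω → Θ)
    (avail : ℕ → Ω → Finset S) (act : ℕ → Ω → S) (R : ℕ → Ω → ℝ) (θhat : ℕ → Ω → Θ) :
    Prop where
  measurable_sample : ∀ t, Measurable (θhat t)
  posterior_sample : ∀ t, ∀ B : Set Θ, MeasurableSet B →
    μ⟦θhat t ⁻¹' B | history avail act R t ⊔ MeasurableSpace.comap θ inferInstance⟧
      =ᵐ[μ] μ⟦θ ⁻¹' B | history avail act R t⟧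
  act_optimal : ∀ t ω, ∀ s ∈ avail t ω, f (θhat t ω) s ≤ f (θhat t ω) (act t ω)

/-- The Bayesian regret `∑_{t ≤ T} E[max_{s ∈ S_t} f_θ(s) - f_θ(act_t)]` of the first `T`
rounds. -/
noncomputable def bayesRegret (μ : Measure Ω) (f : Θ → S → ℝ) (θ : Ω → Θ)
    (avail : ℕ → Ω → Finset S) (act : ℕ → Ω → S) (T : ℕ) : ℝ :=
  ∑ t ∈ Finset.range T,
    ∫ ω, ((⨆ s : {s // s ∈ avail t ω}, f (θ ω) s) - f (θ ω) (act t ω)) ∂μ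

end Interaction

end SuperArmBandit

/-!
Thompson sampling has small Bayesian regret because the sampled parameter and the true one are
exchangeable given the history. As the presented set belongs to the history, the best value under
`θ` has the same mean as the best value under the sample `θhat t`, so the regret of a round is at
most the mean of `f (θhat t) (act t) - f θ (act t)` (`integral_regret_le`).

Both functions lie, up to probability `δ` each, in the same least-squares confidence set
(`InConfidence`). For `θ` this is an exponential supermartingale bound with a union over a finite
sup-norm cover (`IsInteraction.measureReal_not_inConfidence_le`); for `θhat t` it follows from that
for `θ`, as the confidence set is a function of the history
(`measureReal_sample_not_inConfidence_eq`). These failures cost at most `2 δ T C ≤ C`.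

Otherwise the two functions are within `4 β` of each other, in sum of squares over the past
actions. If they still differ by more than `ε` at the current action, that action is
`ε`-independent of one of any `⌊4 β / ε²⌋ + 1` disjoint sets of past rounds. A greedy colouring
(`exists_independent_coloring`) turns this into at most `(4 β / ε² + 1) dim_E` such rounds
(`card_le_of_wide`), and sorting the rounds by their gap gives the deterministic bound
`sum_width_le`.
-/

namespace SuperArmBandit

/-! ### Counting wide rounds with the margin dimension -/

section Eluder

variable {S : Type*}

theorem HasIndependentSeq.le_eluderDim [Fintype S] {F : Set (S → ℝ)} {ε₀ ε : ℝ} {n : ℕ}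
    (h : HasIndependentSeq F ε n) (hε : ε₀ ≤ ε) : n ≤ (eluderDim F ε₀).toNat := by
  obtain ⟨s, ε', hε', hs⟩ := h
  have h1 : (n : ℕ∞) ≤ eluderDim F ε₀ :=
    le_iSup₂_of_le (f := fun (n : ℕ) (_ : HasIndependentSeq F ε₀ n) => (n : ℕ∞)) n
      ⟨s, ε', hε.trans hε', hs⟩ le_rfl
  rw [← ENat.natCast_toNat (eluderDim_ne_top F ε₀)] at h1
  exact_mod_cast h1

/-- A finite set of rounds in which every action is `ε`-independent of the earlier actions of
the set, listed in increasing order, is an independent sequence. -/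
theorem hasIndependentSeq_card {F : Set (S → ℝ)} {ε : ℝ} {a : ℕ → S} {I : Finset ℕ}
    (h : ∀ t ∈ I, ¬ EpsDependent F ε (a t) {k ∈ I | k < t} a) :
    HasIndependentSeq F ε I.card := by
  let e := I.orderEmbOfFin rfl
  refine ⟨fun i => a (e i), ε, le_rfl, fun k hk => h (e k) (I.orderEmbOfFin_mem rfl k) ?_⟩
  have himg : ({j ∈ I | j < e k} : Finset ℕ) = (Finset.Iio k).map e.toEmbedding := by
    ext j
    simp only [Finset.mem_filter, Finset.mem_map, Finset.mem_Iio, RelEmbedding.coe_toEmbedding]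
    constructor
    · rintro ⟨hj, hlt⟩
      have : j ∈ Set.range e := by simpa [e] using hj
      obtain ⟨i, rfl⟩ := this
      exact ⟨i, e.lt_iff_lt.1 hlt, rfl⟩
    · rintro ⟨i, hi, rfl⟩
      exact ⟨I.orderEmbOfFin_mem rfl i, e.lt_iff_lt.2 hi⟩
  intro f hf g hg hfg
  refine hk f hf g hg ?_
  rw [himg, Finset.sum_map] at hfg
  exact hfg

/-- Greedy colouring: if, whatever the partition of the earlier rounds into `K` classes, the
action of each round is `ε`-independent of one of the classes, then the rounds can be coloured
with `K` colours so that every colour class is an independent sequence. -/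
theorem exists_independent_coloring {F : Set (S → ℝ)} {ε : ℝ} {a : ℕ → S} {K : ℕ} [NeZero K]
    (J : Finset ℕ)
    (h : ∀ t ∈ J, ∀ c : ℕ → Fin K, ∃ j, ¬ EpsDependent F ε (a t) {k ∈ J | k < t ∧ c k = j} a) :
    ∃ c : ℕ → Fin K, ∀ t ∈ J, ¬ EpsDependent F ε (a t) {k ∈ J | k < t ∧ c k = c t} a := by
  classical
  induction J using Finset.induction_on_max with
  | empty => exact ⟨fun _ => 0, by simp⟩
  | insert m J hm ih =>
    have hfil : ∀ t ∈ J, ∀ p : ℕ → Prop, ∀ [DecidablePred p],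
        ({k ∈ insert m J | k < t ∧ p k} : Finset ℕ) = {k ∈ J | k < t ∧ p k} := by
      intro t ht p _
      rw [Finset.filter_insert, if_neg]
      exact fun hlt => lt_asymm hlt.1 (hm t ht)
    obtain ⟨c, hc⟩ := ih fun t ht c => by
      obtain ⟨j, hj⟩ := h t (Finset.mem_insert_of_mem ht) c
      exact ⟨j, by rwa [hfil t ht (fun k => c k = j)] at hj⟩
    obtain ⟨j, hj⟩ := h m (Finset.mem_insert_self _ _) c
    refine ⟨Function.update c m j, fun t ht => ?_⟩
    have hne : ∀ k ∈ J, Function.update c m j k = c k := fun k hk =>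
      Function.update_of_ne (hm k hk).ne _ _
    rcases Finset.mem_insert.1 ht with rfl | ht
    · rw [Function.update_self]
      have heq : ({k ∈ insert t J | k < t ∧ Function.update c t j k = j} : Finset ℕ)
          = {k ∈ insert t J | k < t ∧ c k = j} := by
        refine Finset.filter_congr fun k _ => and_congr_right fun hlt => ?_
        rw [Function.update_of_ne hlt.ne]
      rwa [heq]
    · rw [hfil t ht (fun k => Function.update c m j k = Function.update c m j t), hne t ht]
      have heq : ({k ∈ J | k < t ∧ Function.update c m j k = c t} : Finset ℕ)
          = {k ∈ J | k < t ∧ c k = c t} := by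
        refine Finset.filter_congr fun k hk => and_congr_right fun _ => ?_
        rw [hne k hk]
      rw [heq]
      exact hc t ht

/-- If in every round of `J` two functions of the class differ by more than `ε` at the current
action, although the sum of their squared differences over the past actions is at most `b`,
then `J` has at most `(b / ε² + 1) dim_E` rounds: the current action can be `ε`-dependent on
at most `b / ε²` disjoint sets of past rounds. -/
theorem card_le_of_wide [Fintype S] {F : Set (S → ℝ)} {ε₀ ε b : ℝ} (hε : 0 < ε)
    (hεε : ε₀ ≤ ε) (hb : 0 ≤ b) {a : ℕ → S} (u v : ℕ → S → ℝ) (J : Finset ℕ)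
    (hu : ∀ t ∈ J, u t ∈ F) (hv : ∀ t ∈ J, v t ∈ F)
    (hsum : ∀ t ∈ J, ∑ k ∈ Finset.range t, (u t (a k) - v t (a k)) ^ 2 ≤ b)
    (hwide : ∀ t ∈ J, ε < |u t (a t) - v t (a t)|) :
    (J.card : ℝ) ≤ (b / ε ^ 2 + 1) * (eluderDim F ε₀).toNat := by
  classical
  set K := ⌊b / ε ^ 2⌋₊ + 1 with hK
  have hKb : b < K * ε ^ 2 := by
    have := Nat.lt_floor_add_one (b / ε ^ 2)
    rw [div_lt_iff₀ (by positivity)] at this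
    rw [hK]; push_cast; exact this
  have : NeZero K := ⟨by omega⟩
  obtain ⟨c, hc⟩ := exists_independent_coloring (F := F) (ε := ε) (a := a) (K := K) J (by
    intro t ht c
    by_contra! hdep
    -- each of the `K` classes would contribute more than `ε²` to a sum that is at most `b`
    have hbig : ∀ j : Fin K,
        ε ^ 2 ≤ ∑ k ∈ J with k < t ∧ c k = j, (u t (a k) - v t (a k)) ^ 2 := by
      intro j
      by_contra! hlt
      have h1 := hdep j (u t) (hu t ht) (v t) (hv t ht)
        ((Real.sqrt_le_sqrt hlt.le).trans_eq (Real.sqrt_sq hε.le))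
      exact absurd (hwide t ht) (not_lt.2 h1)
    have h2 : ∑ j : Fin K, ∑ k ∈ J with k < t ∧ c k = j, (u t (a k) - v t (a k)) ^ 2
        ≤ ∑ k ∈ Finset.range t, (u t (a k) - v t (a k)) ^ 2 := by
      simp_rw [← Finset.filter_filter]
      rw [Finset.sum_fiberwise]
      refine Finset.sum_le_sum_of_subset_of_nonneg ?_ fun _ _ _ => sq_nonneg _
      intro k hk
      exact Finset.mem_range.2 (Finset.mem_filter.1 hk).2
    have h3 := Finset.sum_le_sum fun j (_ : j ∈ (Finset.univ : Finset (Fin K))) => hbig j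
    simp only [Finset.sum_const, Finset.card_univ, Fintype.card_fin, nsmul_eq_mul] at h3
    linarith [hsum t ht])
  have hclass : ∀ j : Fin K, ({k ∈ J | c k = j} : Finset ℕ).card ≤ (eluderDim F ε₀).toNat := by
    intro j
    refine (hasIndependentSeq_card (F := F) (ε := ε) (a := a) ?_).le_eluderDim hεε
    intro t ht
    obtain ⟨htJ, htj⟩ := Finset.mem_filter.1 ht
    have heq : ({k ∈ {k ∈ J | c k = j} | k < t} : Finset ℕ) = {k ∈ J | k < t ∧ c k = c t} := by
      ext k
      simp only [Finset.mem_filter, htj]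
      tauto
    rw [heq]
    exact hc t htJ
  have hcard : J.card ≤ K * (eluderDim F ε₀).toNat := by
    rw [Finset.card_eq_sum_card_fiberwise (f := c) (t := Finset.univ) (by simp)]
    refine (Finset.sum_le_sum fun j _ => hclass j).trans_eq ?_
    simp
  have hfl : (K : ℝ) ≤ b / ε ^ 2 + 1 := by
    rw [hK]; push_cast
    have := Nat.floor_le (a := b / ε ^ 2) (by positivity)
    linarith
  calc (J.card : ℝ) ≤ K * (eluderDim F ε₀).toNat := by exact_mod_cast hcard
    _ ≤ _ := by gcongr

end Eluder

/-! ### Summing the widths -/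

theorem sum_inv_sqrt_le (n : ℕ) :
    ∑ i ∈ Finset.range n, 1 / √((i : ℝ) + 1) ≤ 2 * √(n : ℝ) := by
  induction n with
  | zero => simp
  | succ n ih =>
    rw [Finset.sum_range_succ]
    have h0 : (0 : ℝ) ≤ n := Nat.cast_nonneg n
    have hpos : 0 < √((n : ℝ) + 1) := Real.sqrt_pos.2 (by positivity)
    have hs1 := Real.sq_sqrt h0
    have hs2 := Real.sq_sqrt (by positivity : (0 : ℝ) ≤ n + 1)
    have : 1 / √((n : ℝ) + 1) ≤ 2 * √((n : ℝ) + 1) - 2 * √(n : ℝ) := by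
      rw [div_le_iff₀ hpos]
      nlinarith [sq_nonneg (√((n : ℝ) + 1) - √(n : ℝ))]
    push_cast
    linarith

/-- If at most `(b / ε² + 1) d` of the numbers `w t ≤ C` exceed `ε`, for every `ε ≥ ε₀`, then the
`i`-th largest of those above `ε₀` is at most `C` for `i < d` and at most `√(d b / (i - d + 1))`
from then on, which bounds their sum. -/
theorem sum_le_of_card_le {w : ℕ → ℝ} {ε₀ b C : ℝ} {d : ℕ} (hε₀ : 0 < ε₀)
    (hC : 0 ≤ C) (J : Finset ℕ) (hw : ∀ t ∈ J, w t ≤ C) (hw₀ : ∀ t ∈ J, ε₀ < w t)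
    (hcard : ∀ ε, ε₀ ≤ ε → ∀ I ⊆ J, (∀ t ∈ I, ε < w t) → (I.card : ℝ) ≤ (b / ε ^ 2 + 1) * d) :
    ∑ t ∈ J, w t ≤ d * C + √(d * b) * ∑ i ∈ Finset.range (J.card - d), 1 / √((i : ℝ) + 1) := by
  classical
  induction J using Finset.induction_on_min_value w with
  | empty => simp; positivity
  | insert m J hmJ hmin ih =>
    have ih := ih (fun t ht => hw t (Finset.mem_insert_of_mem ht))
      (fun t ht => hw₀ t (Finset.mem_insert_of_mem ht))
      (fun ε hε I hI => hcard ε hε I (hI.trans (Finset.subset_insert _ _)))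
    rw [Finset.sum_insert hmJ, Finset.card_insert_of_notMem hmJ]
    have hm := Finset.mem_insert_self m J
    rcases lt_or_ge J.card d with hlt | hge
    · rw [Nat.sub_eq_zero_of_le hlt]
      simp only [Finset.range_zero, Finset.sum_empty, mul_zero, add_zero]
      have h1 : ∑ t ∈ insert m J, w t ≤ (insert m J).card • C := Finset.sum_le_card_nsmul _ _ _ hw
      rw [Finset.sum_insert hmJ, Finset.card_insert_of_notMem hmJ, nsmul_eq_mul] at h1
      refine h1.trans ?_
      have : ((J.card + 1 : ℕ) : ℝ) ≤ d := by exact_mod_cast hlt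
      gcongr
    · obtain ⟨r, hr⟩ := Nat.exists_eq_add_of_le hge
      rw [hr, show d + r + 1 - d = r + 1 by omega, Finset.sum_range_succ]
      rw [hr, show d + r - d = r by omega] at ih
      have hwm : w m ≤ √(d * b) * (1 / √((r : ℝ) + 1)) := by
        refine le_of_forall_lt_imp_le_of_dense fun ε hε => ?_
        have hmax : max ε ε₀ < w m := max_lt hε (hw₀ m hm)
        have h1 := hcard (max ε ε₀) (le_max_right _ _) (insert m J) subset_rfl (by
          intro t ht
          rcases Finset.mem_insert.1 ht with rfl | ht
          · exact hmax
          · exact hmax.trans_le (hmin t ht))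
        refine (le_max_left ε ε₀).trans ?_
        have hpos : 0 < max ε ε₀ := lt_max_of_lt_right hε₀
        set x := max ε ε₀
        rw [Finset.card_insert_of_notMem hmJ, hr] at h1
        push_cast at h1
        rw [mul_one_div, le_div_iff₀ (Real.sqrt_pos.2 (by positivity))]
        refine Real.le_sqrt_of_sq_le ?_
        rw [mul_pow, Real.sq_sqrt (by positivity)]
        have h2 : (r : ℝ) + 1 ≤ b / x ^ 2 * d := by linarith
        calc x ^ 2 * ((r : ℝ) + 1) ≤ x ^ 2 * (b / x ^ 2 * d) := by gcongr
          _ = d * b := by field_simp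
      linarith

/-- The deterministic regret bound: widths of functions that agree on the past up to `4 β` in
sum of squares add up to at most `1 + d C + 4 √(d β T)`. -/
theorem sum_width_le {S : Type*} [Fintype S] {F : Set (S → ℝ)} {C β : ℝ} (hβ : 0 ≤ β)
    {T : ℕ} (hT : 1 ≤ T) (hF : ∀ f ∈ F, ∀ s, f s ∈ Set.Icc 0 C) (hC : 0 ≤ C)
    (a : ℕ → S) (u v : ℕ → S → ℝ) (G : Finset ℕ) (hG : G ⊆ Finset.range T)
    (hu : ∀ t ∈ G, u t ∈ F) (hv : ∀ t ∈ G, v t ∈ F)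
    (hsum : ∀ t ∈ G, ∑ k ∈ Finset.range t, (u t (a k) - v t (a k)) ^ 2 ≤ 4 * β) :
    ∑ t ∈ G, |u t (a t) - v t (a t)| ≤
      1 + (eluderDim F (1 / (T : ℝ))).toNat * C
        + 4 * √((eluderDim F (1 / (T : ℝ))).toNat * β * T) := by
  classical
  set d := (eluderDim F (1 / (T : ℝ))).toNat
  set w : ℕ → ℝ := fun t => |u t (a t) - v t (a t)| with hw
  have hT0 : (0 : ℝ) < T := by exact_mod_cast hT
  have hGT : (G.card : ℝ) ≤ T := by
    have := Finset.card_le_card hG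
    rw [Finset.card_range] at this
    exact_mod_cast this
  set J := {t ∈ G | 1 / (T : ℝ) < w t}
  have hJG : J ⊆ G := Finset.filter_subset _ _
  have hsmall : ∑ t ∈ G with ¬ 1 / (T : ℝ) < w t, w t ≤ 1 := by
    calc ∑ t ∈ G with ¬ 1 / (T : ℝ) < w t, w t
        ≤ ({t ∈ G | ¬ 1 / (T : ℝ) < w t} : Finset ℕ).card • (1 / (T : ℝ)) :=
          Finset.sum_le_card_nsmul _ _ _ fun t ht => not_lt.1 (Finset.mem_filter.1 ht).2
      _ ≤ G.card • (1 / (T : ℝ)) := by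
          refine nsmul_le_nsmul_left (by positivity) (Finset.card_filter_le _ _)
      _ ≤ 1 := by
          rw [nsmul_eq_mul, mul_one_div, div_le_one hT0]
          exact hGT
  have hlarge := sum_le_of_card_le (w := w) (ε₀ := 1 / (T : ℝ)) (b := 4 * β) (C := C) (d := d)
    (by positivity) hC J
    (fun t ht => by
      have h1 := hF _ (hu t (hJG ht)) (a t)
      have h2 := hF _ (hv t (hJG ht)) (a t)
      exact abs_le.2 ⟨by linarith [h1.1, h2.2], by linarith [h1.2, h2.1]⟩)
    (fun t ht => (Finset.mem_filter.1 ht).2)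
    (fun ε hε I hI hwide => card_le_of_wide (lt_of_lt_of_le (by positivity) hε) hε
      (by positivity) u v I (fun t ht => hu t (hJG (hI ht))) (fun t ht => hv t (hJG (hI ht)))
      (fun t ht => hsum t (hJG (hI ht))) hwide)
  have hroot : √(d * (4 * β)) * ∑ i ∈ Finset.range (J.card - d), 1 / √((i : ℝ) + 1)
      ≤ 4 * √(d * β * T) := by
    have h1 : ((J.card - d : ℕ) : ℝ) ≤ T := by
      refine le_trans ?_ hGT
      exact_mod_cast (Nat.sub_le _ _).trans (Finset.card_le_card hJG)
    calc √(d * (4 * β)) * ∑ i ∈ Finset.range (J.card - d), 1 / √((i : ℝ) + 1)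
        ≤ √(d * (4 * β)) * (2 * √(T : ℝ)) := by
          gcongr
          exact (sum_inv_sqrt_le _).trans (by gcongr)
      _ = 4 * √(d * β * T) := by
          rw [show (d : ℝ) * (4 * β) = 2 ^ 2 * (d * β) by ring, Real.sqrt_mul (by positivity),
            Real.sqrt_sq (by norm_num), Real.sqrt_mul (by positivity) (T : ℝ)]
          ring
  have hsplit := Finset.sum_filter_add_sum_filter_not G (fun t => 1 / (T : ℝ) < w t) w
  change ∑ t ∈ G, w t ≤ _
  linarith

/-! ### An exponential supermartingale -/

/-- For `|e| ≤ 1`, convexity puts `exp (x e)` below the chord `cosh x + e sinh x`. -/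
theorem exp_mul_le_exp_half_sq_add (x : ℝ) {e : ℝ} (he : |e| ≤ 1) :
    Real.exp (x * e) ≤ Real.exp (x ^ 2 / 2) + e * Real.sinh x := by
  obtain ⟨h1, h2⟩ := abs_le.1 he
  have hconv := convexOn_exp.2 (Set.mem_univ x) (Set.mem_univ (-x))
    (by linarith : 0 ≤ (1 + e) / 2) (by linarith : 0 ≤ (1 - e) / 2) (by ring)
  simp only [smul_eq_mul] at hconv
  have hx : (1 + e) / 2 * x + (1 - e) / 2 * -x = x * e := by ring
  rw [hx] at hconv
  have hcosh := Real.cosh_le_exp_half_sq x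
  rw [Real.cosh_eq] at hcosh
  rw [Real.sinh_eq]
  linarith

section Supermartingale

variable {Ω : Type*} [mΩ : MeasurableSpace Ω] {μ : Measure Ω} [IsProbabilityMeasure μ]

/-- If the `e t` are bounded by `1` and centered given `𝒢 t`, and the `d t` are predictable, then
`exp (∑_{k < t} (d k e k / 2 - (d k)² / 8))` is a supermartingale started at `1`. -/
theorem integral_exp_sum_le_one {𝒢 : ℕ → MeasurableSpace Ω} (h𝒢 : ∀ t, 𝒢 t ≤ mΩ)
    {d e : ℕ → Ω → ℝ} {C : ℝ} (hd : ∀ t, ∀ k ≤ t, Measurable[𝒢 t] (d k))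
    (he : ∀ t, ∀ k < t, Measurable[𝒢 t] (e k)) (hdC : ∀ t ω, |d t ω| ≤ C)
    (heb : ∀ t, ∀ᵐ ω ∂μ, |e t ω| ≤ 1) (hec : ∀ t, μ[e t | 𝒢 t] =ᵐ[μ] 0) (t : ℕ) :
    Integrable (fun ω => Real.exp (∑ k ∈ Finset.range t,
        (d k ω * e k ω / 2 - d k ω ^ 2 / 8))) μ ∧
      ∫ ω, Real.exp (∑ k ∈ Finset.range t, (d k ω * e k ω / 2 - d k ω ^ 2 / 8)) ∂μ ≤ 1 := by
  have hdm : ∀ t, Measurable (d t) := fun t => (hd t t le_rfl).mono (h𝒢 t) le_rfl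
  have hem : ∀ t, Measurable (e t) := fun t =>
    (he (t + 1) t t.lt_succ_self).mono (h𝒢 (t + 1)) le_rfl
  have heint : ∀ t, Integrable (e t) μ := fun t =>
    Integrable.of_bound (hem t).aestronglyMeasurable 1 (by simpa using heb t)
  set M : ℕ → Ω → ℝ := fun t ω =>
    Real.exp (∑ k ∈ Finset.range t, (d k ω * e k ω / 2 - d k ω ^ 2 / 8)) with hM
  have hMm : ∀ t, Measurable[𝒢 t] (M t) := by
    intro t
    refine Real.measurable_exp.comp (Finset.measurable_fun_sum _ fun k hk => ?_)
    have hk := Finset.mem_range.1 hk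
    exact (((hd t k hk.le).mul (he t k hk)).div_const 2).sub (((hd t k hk.le).pow_const 2).div_const 8)
  have hMb : ∀ t, ∀ᵐ ω ∂μ, M t ω ≤ Real.exp (t * (C / 2)) := by
    intro t
    filter_upwards [ae_all_iff.2 heb] with ω hω
    refine Real.exp_le_exp.2 ?_
    have h1 : ∀ k ∈ Finset.range t, d k ω * e k ω / 2 - d k ω ^ 2 / 8 ≤ C / 2 := by
      intro k _
      have h2 : d k ω * e k ω ≤ C := by
        calc d k ω * e k ω ≤ |d k ω| * |e k ω| := by rw [← abs_mul]; exact le_abs_self _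
          _ ≤ |d k ω| * 1 := by gcongr; exact hω k
          _ ≤ C := by rw [mul_one]; exact hdC k ω
      nlinarith [sq_nonneg (d k ω)]
    simpa using Finset.sum_le_card_nsmul _ _ _ h1
  have hMint : ∀ t, Integrable (M t) μ := fun t =>
    Integrable.of_bound ((hMm t).mono (h𝒢 t) le_rfl).aestronglyMeasurable
      (Real.exp (t * (C / 2))) (by
        filter_upwards [hMb t] with ω hω
        rwa [Real.norm_of_nonneg (Real.exp_nonneg _)])
  refine ⟨hMint t, ?_⟩
  change ∫ ω, M t ω ∂μ ≤ 1
  induction t with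
  | zero => simp [hM]
  | succ t ih =>
    -- the predictable factor in front of the centered term `e t`
    set X : Ω → ℝ := fun ω => M t ω * (Real.exp (-(d t ω ^ 2 / 8)) * Real.sinh (d t ω / 2))
      with hX
    have hXm : Measurable[𝒢 t] X := by
      have hdt := hd t t le_rfl
      refine (hMm t).mul (Measurable.mul ?_ ?_)
      · exact Real.measurable_exp.comp (((hdt.pow_const 2).div_const 8).neg)
      · exact Real.measurable_sinh.comp (hdt.div_const 2)
    have hXeint : Integrable (X * e t) μ := by
      refine Integrable.of_bound
        ((hXm.mono (h𝒢 t) le_rfl).mul (hem t)).aestronglyMeasurable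
        (Real.exp (t * (C / 2)) * (1 * Real.cosh (C / 2)) * 1) ?_
      filter_upwards [hMb t, heb t] with ω h1 h2
      simp only [hX, Pi.mul_apply, norm_mul, Real.norm_eq_abs, Real.abs_exp]
      rw [abs_of_nonneg (a := M t ω) (Real.exp_nonneg _)]
      have h3 : Real.exp (-(d t ω ^ 2 / 8)) ≤ 1 := Real.exp_le_one_iff.2 (by
        have := sq_nonneg (d t ω); linarith)
      have h4 : |Real.sinh (d t ω / 2)| ≤ Real.cosh (C / 2) := by
        have h5 : |d t ω / 2| ≤ |C / 2| := by
          have := hdC t ω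
          have hC := (abs_nonneg _).trans this
          rw [abs_of_nonneg (a := C / 2) (by linarith), abs_div, abs_of_pos (two_pos (α := ℝ))]
          linarith
        have h6 := Real.cosh_le_cosh.2 h5
        refine le_trans ?_ h6
        rw [abs_le]
        rw [Real.sinh_eq, Real.cosh_eq]
        have := Real.exp_pos (d t ω / 2)
        have := Real.exp_pos (-(d t ω / 2))
        constructor <;> linarith
      gcongr
    have hzero : ∫ ω, (X * e t) ω ∂μ = 0 := by
      rw [← integral_condExp (h𝒢 t)]
      have h1 := condExp_mul_of_stronglyMeasurable_left hXm.stronglyMeasurable hXeint (heint t)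
      rw [integral_congr_ae (g := fun _ => (0 : ℝ)) ?_, integral_zero]
      filter_upwards [h1, hec t] with ω h2 h3
      rw [h2, Pi.mul_apply, h3, Pi.zero_apply, mul_zero]
    have hstep : M (t + 1) ≤ᵐ[μ] fun ω => M t ω + (X * e t) ω := by
      filter_upwards [heb t] with ω hω
      have h1 := exp_mul_le_exp_half_sq_add (d t ω / 2) hω
      have h2 : M (t + 1) ω
          = M t ω * (Real.exp (-(d t ω ^ 2 / 8)) * Real.exp (d t ω / 2 * e t ω)) := by
        simp only [hM]
        rw [Finset.sum_range_succ, Real.exp_add, ← Real.exp_add (-(d t ω ^ 2 / 8))]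
        congr 2
        ring
      have h3 : Real.exp (-(d t ω ^ 2 / 8)) * Real.exp ((d t ω / 2) ^ 2 / 2) = 1 := by
        rw [← Real.exp_add, Real.exp_eq_one_iff]
        ring
      rw [h2]
      calc M t ω * (Real.exp (-(d t ω ^ 2 / 8)) * Real.exp (d t ω / 2 * e t ω))
          ≤ M t ω * (Real.exp (-(d t ω ^ 2 / 8)) *
              (Real.exp ((d t ω / 2) ^ 2 / 2) + e t ω * Real.sinh (d t ω / 2))) := by
            have := Real.exp_nonneg (∑ k ∈ Finset.range t, (d k ω * e k ω / 2 - d k ω ^ 2 / 8))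
            gcongr
        _ = M t ω + (X * e t) ω := by
            rw [mul_add (Real.exp _), h3]
            simp only [hX, Pi.mul_apply]
            ring
    calc ∫ ω, M (t + 1) ω ∂μ ≤ ∫ ω, (M t ω + (X * e t) ω) ∂μ :=
          integral_mono_ae (hMint _) ((hMint t).add hXeint) hstep
      _ = ∫ ω, M t ω ∂μ := by rw [integral_add (hMint t) hXeint, hzero, add_zero]
      _ ≤ 1 := ih

/-- Exponential Markov inequality for the supermartingale above. -/
theorem measureReal_log_le_sum_le {𝒢 : ℕ → MeasurableSpace Ω} (h𝒢 : ∀ t, 𝒢 t ≤ mΩ)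
    {d e : ℕ → Ω → ℝ} {C : ℝ} (hd : ∀ t, ∀ k ≤ t, Measurable[𝒢 t] (d k))
    (he : ∀ t, ∀ k < t, Measurable[𝒢 t] (e k)) (hdC : ∀ t ω, |d t ω| ≤ C)
    (heb : ∀ t, ∀ᵐ ω ∂μ, |e t ω| ≤ 1) (hec : ∀ t, μ[e t | 𝒢 t] =ᵐ[μ] 0) (t : ℕ)
    {L : ℝ} (hL : 0 < L) :
    μ.real {ω | Real.log L ≤ ∑ k ∈ Finset.range t, (d k ω * e k ω / 2 - d k ω ^ 2 / 8)}
      ≤ 1 / L := by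
  obtain ⟨hint, hle⟩ := integral_exp_sum_le_one h𝒢 hd he hdC heb hec t
  have h1 := mul_meas_ge_le_integral_of_nonneg (ae_of_all _ fun ω => Real.exp_nonneg _) hint L
  have h2 : {ω | Real.log L ≤ ∑ k ∈ Finset.range t, (d k ω * e k ω / 2 - d k ω ^ 2 / 8)}
      = {ω | L ≤ Real.exp (∑ k ∈ Finset.range t, (d k ω * e k ω / 2 - d k ω ^ 2 / 8))} := by
    ext ω
    exact Real.log_le_iff_le_exp hL
  rw [h2, le_div_iff₀ hL]
  linarith

end Supermartingale

/-! ### Sampling from the posterior -/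

section Posterior

variable {Ω Θ : Type*} {m m' mΩ : MeasurableSpace Ω} [mΘ : MeasurableSpace Θ] {μ : Measure Ω}
  [IsProbabilityMeasure μ]

theorem setIntegral_condExp_preimage (hm : m ≤ m') (hm' : m' ≤ mΩ) {A : Set Ω}
    (hA : MeasurableSet[m] A) {W : Ω → Θ} (hW : Measurable W) {B : Set Θ}
    (hB : MeasurableSet B) :
    ∫ ω in A, (μ⟦W ⁻¹' B | m'⟧) ω ∂μ = μ.real (A ∩ W ⁻¹' B) := by
  rw [setIntegral_condExp hm' ((integrable_const (1 : ℝ)).indicator (hW hB)) (hm _ hA),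
    setIntegral_indicator (hW hB)]
  simp

/-- A draw `Y` from the conditional law of `Z` given `m` has, jointly with any `m`-measurable `H`,
the law of `Z`. -/
theorem map_prodMk_eq_of_condExp_eq {X : Type*} [mX : MeasurableSpace X]
    (hm : m ≤ m') (hm' : m' ≤ mΩ) {H : Ω → X} (hH : Measurable[m] H)
    {Y Z : Ω → Θ} (hY : Measurable Y) (hZ : Measurable Z)
    (h : ∀ B, MeasurableSet B → μ⟦Y ⁻¹' B | m'⟧ =ᵐ[μ] μ⟦Z ⁻¹' B | m⟧) :
    μ.map (fun ω => (H ω, Y ω)) = μ.map (fun ω => (H ω, Z ω)) := by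
  have hHm : Measurable H := hH.mono (hm.trans hm') le_rfl
  have : IsProbabilityMeasure (μ.map (fun ω => (H ω, Y ω))) :=
    Measure.isProbabilityMeasure_map (hHm.prodMk hY).aemeasurable
  refine Measure.ext_prod fun {s B} hs hB => ?_
  rw [Measure.map_apply (hHm.prodMk hY) (hs.prod hB), Measure.map_apply (hHm.prodMk hZ) (hs.prod hB)]
  have hA : MeasurableSet[m] (H ⁻¹' s) := hH hs
  have h1 := setIntegral_condExp_preimage (μ := μ) hm hm' hA hY hB
  have h2 := setIntegral_condExp_preimage (μ := μ) le_rfl (hm.trans hm') hA hZ hB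
  rw [setIntegral_congr_ae (hHm hs) ((h B hB).mono fun ω hω _ => hω), h2] at h1
  have h3 := (measureReal_eq_measureReal_iff (measure_ne_top _ _) (measure_ne_top _ _)).1 h1
  exact h3.symm

/-- Events that depend on an `m`-measurable `H` and on the parameter have the same probability at
a posterior draw `Y` as at the true parameter `Z`. -/
theorem measureReal_eq_of_condExp_eq {X : Type*} [mX : MeasurableSpace X]
    (hm : m ≤ m') (hm' : m' ≤ mΩ) {H : Ω → X} (hH : Measurable[m] H)
    {Y Z : Ω → Θ} (hY : Measurable Y) (hZ : Measurable Z)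
    (h : ∀ B, MeasurableSet B → μ⟦Y ⁻¹' B | m'⟧ =ᵐ[μ] μ⟦Z ⁻¹' B | m⟧)
    {E : Set (X × Θ)} (hE : MeasurableSet E) :
    μ.real {ω | (H ω, Y ω) ∈ E} = μ.real {ω | (H ω, Z ω) ∈ E} := by
  have hHm : Measurable H := hH.mono (hm.trans hm') le_rfl
  have h2 := congrArg (fun ν => ν E) (map_prodMk_eq_of_condExp_eq hm hm' hH hY hZ h)
  rw [Measure.map_apply (hHm.prodMk hY) hE, Measure.map_apply (hHm.prodMk hZ) hE] at h2
  exact congrArg ENNReal.toReal h2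

/-- Quantities that depend on an `m`-measurable `H` and on the parameter have the same mean at a
posterior draw `Y` as at the true parameter `Z`. -/
theorem integral_eq_of_condExp_eq {X : Type*} [mX : MeasurableSpace X]
    (hm : m ≤ m') (hm' : m' ≤ mΩ) {H : Ω → X} (hH : Measurable[m] H)
    {Y Z : Ω → Θ} (hY : Measurable Y) (hZ : Measurable Z)
    (h : ∀ B, MeasurableSet B → μ⟦Y ⁻¹' B | m'⟧ =ᵐ[μ] μ⟦Z ⁻¹' B | m⟧)
    {φ : X × Θ → ℝ} (hφ : Measurable φ) :
    ∫ ω, φ (H ω, Y ω) ∂μ = ∫ ω, φ (H ω, Z ω) ∂μ := by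
  have hHm : Measurable H := hH.mono (hm.trans hm') le_rfl
  have h2 := congrArg (fun ν => ∫ x, φ x ∂ν) (map_prodMk_eq_of_condExp_eq hm hm' hH hY hZ h)
  rwa [integral_map (hHm.prodMk hY).aemeasurable hφ.aestronglyMeasurable,
    integral_map (hHm.prodMk hZ).aemeasurable hφ.aestronglyMeasurable] at h2

end Posterior

/-! ### Least-squares confidence sets -/

section Confidence

variable {S : Type*}

/-- `h` lies in the confidence set built from the first `t` actions `a` and rewards `r`: it is
within `β`, in sum of squares over these actions, of the least-squares fits from the finite
cover `𝒢`. Quantifying over all minimizers avoids a measurable choice of one of them. -/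
def InConfidence (𝒢 : Finset (S → ℝ)) (β : ℝ) (t : ℕ) (a : ℕ → S) (r : ℕ → ℝ) (h : S → ℝ) :
    Prop :=
  ∀ g ∈ 𝒢,
    (∀ g' ∈ 𝒢, ∑ k ∈ Finset.range t, (g (a k) - r k) ^ 2
      ≤ ∑ k ∈ Finset.range t, (g' (a k) - r k) ^ 2) →
    ∑ k ∈ Finset.range t, (g (a k) - h (a k)) ^ 2 ≤ β

theorem InConfidence.sum_sq_sub_le {𝒢 : Finset (S → ℝ)} (h𝒢 : 𝒢.Nonempty) {β : ℝ} {t : ℕ}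
    {a : ℕ → S} {r : ℕ → ℝ} {u v : S → ℝ} (hu : InConfidence 𝒢 β t a r u)
    (hv : InConfidence 𝒢 β t a r v) :
    ∑ k ∈ Finset.range t, (u (a k) - v (a k)) ^ 2 ≤ 4 * β := by
  obtain ⟨g, hg, hmin⟩ := 𝒢.exists_min_image
    (fun g => ∑ k ∈ Finset.range t, (g (a k) - r k) ^ 2) h𝒢
  have h1 := hu g hg hmin
  have h2 := hv g hg hmin
  calc ∑ k ∈ Finset.range t, (u (a k) - v (a k)) ^ 2
      ≤ ∑ k ∈ Finset.range t, (2 * (g (a k) - u (a k)) ^ 2 + 2 * (g (a k) - v (a k)) ^ 2) := by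
        refine Finset.sum_le_sum fun k _ => ?_
        nlinarith [sq_nonneg (g (a k) - u (a k) + (g (a k) - v (a k)))]
    _ ≤ 4 * β := by
        rw [Finset.sum_add_distrib, ← Finset.mul_sum, ← Finset.mul_sum]
        linarith

/-- If the noise `r k - h (a k)` does not correlate too well with any `g - h`, `g ∈ 𝒢`, then `h`
lies in the confidence set: the least-squares fit does no worse than the member of `𝒢` that is
`α`-close to `h`. -/
theorem inConfidence_of_sum_lt {𝒢 : Finset (S → ℝ)} {α β C L : ℝ} {t : ℕ} {a : ℕ → S}
    {r : ℕ → ℝ} {h : S → ℝ} (hα : 0 ≤ α) (hC : ∀ g ∈ 𝒢, ∀ s, |g s - h s| ≤ C)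
    (hr : ∀ k, |r k - h (a k)| ≤ 1) (hclose : ∃ g ∈ 𝒢, ∀ s, |g s - h s| ≤ α)
    (hL : ∀ g ∈ 𝒢, ∑ k ∈ Finset.range t,
      ((g (a k) - h (a k)) * (r k - h (a k)) / 2 - (g (a k) - h (a k)) ^ 2 / 8) ≤ L)
    (hβ : 8 * L + 2 * t * (α * C + 2 * α) ≤ β) : InConfidence 𝒢 β t a r h := by
  intro g hg hmin
  obtain ⟨g', hg', hα'⟩ := hclose
  have hloss : ∀ g : S → ℝ, ∑ k ∈ Finset.range t, (g (a k) - r k) ^ 2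
      = ∑ k ∈ Finset.range t, ((g (a k) - h (a k)) ^ 2
        - 2 * ((g (a k) - h (a k)) * (r k - h (a k)))) +
        ∑ k ∈ Finset.range t, (r k - h (a k)) ^ 2 := by
    intro g
    rw [← Finset.sum_add_distrib]
    exact Finset.sum_congr rfl fun k _ => by ring
  have h1 := hmin g' hg'
  rw [hloss g, hloss g', add_le_add_iff_right] at h1
  have h2 : ∑ k ∈ Finset.range t, ((g' (a k) - h (a k)) ^ 2
      - 2 * ((g' (a k) - h (a k)) * (r k - h (a k)))) ≤ t * (α * C + 2 * α) := by
    have := Finset.sum_le_card_nsmul (Finset.range t) (fun k => (g' (a k) - h (a k)) ^ 2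
      - 2 * ((g' (a k) - h (a k)) * (r k - h (a k)))) (α * C + 2 * α) (by
        intro k _
        have hx := hα' (a k)
        have hy : |g' (a k) - h (a k)| * |g' (a k) - h (a k)| ≤ α * C :=
          mul_le_mul hx (hC g' hg' (a k)) (abs_nonneg _) hα
        have hz : |g' (a k) - h (a k)| * |r k - h (a k)| ≤ α * 1 :=
          mul_le_mul hx (hr k) (abs_nonneg _) hα
        rw [abs_mul_abs_self] at hy
        rw [← abs_mul] at hz
        have := (abs_le.1 hz).1
        nlinarith)
    rwa [Finset.card_range, nsmul_eq_mul] at this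
  have h3 := hL g hg
  rw [Finset.sum_sub_distrib, ← Finset.mul_sum] at h1
  rw [Finset.sum_sub_distrib, ← Finset.sum_div, ← Finset.sum_div] at h3
  linarith

end Confidence

section Measurability

variable {S Θ A : Type*} [MeasurableSpace Θ] {m : MeasurableSpace A}

theorem measurable_apply_of_countable {X : Type*} [Countable X] {F : X → Θ → ℝ}
    (hF : ∀ x, Measurable (F x)) {a : A → X} (ha : Measurable[m, ⊤] a) {h : A → Θ}
    (hh : Measurable h) : Measurable fun y => F (a y) (h y) := by
  let _ : MeasurableSpace X := ⊤
  have h1 : Measurable fun p : X × Θ => F p.1 p.2 := measurable_from_prod_countable_right hF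
  exact h1.comp (ha.prodMk hh)

theorem measurableSet_inConfidence [Finite S] {f : Θ → S → ℝ}
    (hf : ∀ s, Measurable fun ϑ => f ϑ s) (𝒢 : Finset (S → ℝ)) (β : ℝ) {t : ℕ}
    {a : ℕ → A → S} {r : ℕ → A → ℝ} {h : A → Θ} (ha : ∀ k < t, Measurable[m, ⊤] (a k))
    (hr : ∀ k < t, Measurable (r k)) (hh : Measurable h) :
    MeasurableSet {y | InConfidence 𝒢 β t (fun k => a k y) (fun k => r k y) (f (h y))} := by
  have hg : ∀ g : S → ℝ, ∀ k < t, Measurable fun y => g (a k y) := fun g k hk =>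
    measurable_apply_of_countable (F := fun s _ => g s) (fun _ => measurable_const) (ha k hk) hh
  have hloss : ∀ g : S → ℝ, Measurable fun y => ∑ k ∈ Finset.range t, (g (a k y) - r k y) ^ 2 :=
    fun g => Finset.measurable_fun_sum _ fun k hk =>
      ((hg g k (Finset.mem_range.1 hk)).sub (hr k (Finset.mem_range.1 hk))).pow_const 2
  have hdist : ∀ g : S → ℝ,
      Measurable fun y => ∑ k ∈ Finset.range t, (g (a k y) - f (h y) (a k y)) ^ 2 :=
    fun g => Finset.measurable_fun_sum _ fun k hk =>
      ((hg g k (Finset.mem_range.1 hk)).sub (measurable_apply_of_countable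
        (F := fun s ϑ => f ϑ s) hf (ha k (Finset.mem_range.1 hk)) hh)).pow_const 2
  have heq : {y | InConfidence 𝒢 β t (fun k => a k y) (fun k => r k y) (f (h y))}
      = ⋂ g ∈ 𝒢, ((⋂ g' ∈ 𝒢, {y | ∑ k ∈ Finset.range t, (g (a k y) - r k y) ^ 2
          ≤ ∑ k ∈ Finset.range t, (g' (a k y) - r k y) ^ 2})ᶜ
        ∪ {y | ∑ k ∈ Finset.range t, (g (a k y) - f (h y) (a k y)) ^ 2 ≤ β}) := by
    ext y
    simp only [InConfidence, Set.mem_ofPred_eq, Set.mem_iInter, Set.mem_union, Set.mem_compl_iff,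
      imp_iff_not_or]
  rw [heq]
  exact Finset.measurableSet_biInter _ fun g _ =>
    (Finset.measurableSet_biInter _ fun g' _ => measurableSet_le (hloss g) (hloss g')).compl.union
      (measurableSet_le (hdist g) measurable_const)

end Measurability

section Interaction

variable {S Θ Ω : Type*} {avail : ℕ → Ω → Finset S} {act : ℕ → Ω → S} {R : ℕ → Ω → ℝ}

theorem measurable_act_history {k t : ℕ} (hk : k < t) :
    Measurable[history avail act R t, ⊤] (act k) :=
  measurable_iff_comap_le.2 (le_sup_of_le_left (le_iSup_of_le (⟨k, hk⟩ : Fin t)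
    (le_sup_of_le_left le_sup_right)))

theorem measurable_reward_history {k t : ℕ} (hk : k < t) :
    Measurable[history avail act R t] (R k) := by
  refine measurable_iff_comap_le.2 (le_sup_of_le_left (le_iSup_of_le (⟨k, hk⟩ : Fin t) ?_))
  rw [BorelSpace.measurable_eq (α := ℝ)]
  exact le_sup_right

theorem measurable_avail_history (t : ℕ) : Measurable[history avail act R t, ⊤] (avail t) :=
  measurable_iff_comap_le.2 le_sup_right

variable [MeasurableSpace Θ] [mΩ : MeasurableSpace Ω] {μ : Measure Ω}
  {f : Θ → S → ℝ} {θ : Ω → Θ}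

theorem IsInteraction.history_le (hint : IsInteraction μ f θ avail act R) (t : ℕ) :
    history avail act R t ≤ mΩ := by
  refine sup_le (iSup_le fun k => sup_le (sup_le ?_ ?_) ?_) ?_
  · exact (hint.measurable_avail k).comap_le
  · exact (hint.measurable_act k).comap_le
  · rw [← BorelSpace.measurable_eq (α := ℝ)]
    exact (hint.measurable_reward k).comap_le
  · exact (hint.measurable_avail t).comap_le

variable [IsProbabilityMeasure μ] [Finite S]

/-- For a finite cover of the class, the true function leaves the confidence set of a given round
with probability at most `δ`: a union bound over the cover, on the exponential supermartingales
of the `g - f_θ`. A fixed round is enough, since the regret is a sum of expectations. -/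
theorem IsInteraction.measureReal_not_inConfidence_le
    (hint : IsInteraction μ f θ avail act R) (hf : ∀ s, Measurable fun ϑ => f ϑ s)
    {𝒢 : Finset (S → ℝ)} (h𝒢 : 𝒢.Nonempty) {α β C δ : ℝ} (hα : 0 ≤ α) (hδ : 0 < δ)
    (hC : ∀ g ∈ 𝒢, ∀ ϑ s, |g s - f ϑ s| ≤ C) (hcov : ∀ ϑ, ∃ g ∈ 𝒢, ∀ s, |g s - f ϑ s| ≤ α)
    {t : ℕ} (hβ : 8 * Real.log (𝒢.card / δ) + 2 * t * (α * C + 2 * α) ≤ β) :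
    μ.real {ω | ¬ InConfidence 𝒢 β t (fun k => act k ω) (fun k => R k ω) (f (θ ω))} ≤ δ := by
  set e : ℕ → Ω → ℝ := fun t ω => R t ω - f (θ ω) (act t ω) with he
  set d : (S → ℝ) → ℕ → Ω → ℝ := fun g t ω => g (act t ω) - f (θ ω) (act t ω) with hd
  set 𝓜 : ℕ → MeasurableSpace Ω := fun t => history avail act R t
    ⊔ MeasurableSpace.comap θ inferInstance ⊔ MeasurableSpace.comap (act t) ⊤ with h𝓜
  have h𝓜le : ∀ t, 𝓜 t ≤ mΩ := fun t => sup_le (sup_le (hint.history_le t)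
    hint.measurable_param.comap_le) (hint.measurable_act t).comap_le
  have hhist : ∀ t, history avail act R t ≤ 𝓜 t := fun t => le_sup_of_le_left le_sup_left
  have hθm : ∀ t, Measurable[𝓜 t] θ := fun t =>
    measurable_iff_comap_le.2 (le_sup_of_le_left le_sup_right)
  have ham : ∀ t, ∀ k ≤ t, Measurable[𝓜 t, ⊤] (act k) := by
    intro t k hk
    rcases hk.lt_or_eq with hk | rfl
    · exact (measurable_act_history hk).mono (hhist t) le_rfl
    · exact measurable_iff_comap_le.2 le_sup_right
  have hfm : ∀ t, ∀ k ≤ t, Measurable[𝓜 t] fun ω => f (θ ω) (act k ω) := fun t k hk =>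
    measurable_apply_of_countable (m := 𝓜 t) (F := fun s ϑ => f ϑ s) hf (ham t k hk) (hθm t)
  have hdm : ∀ g t, ∀ k ≤ t, Measurable[𝓜 t] (d g k) := fun g t k hk =>
    (measurable_apply_of_countable (m := 𝓜 t) (F := fun s _ => g s) (fun _ => measurable_const)
      (ham t k hk) (hθm t)).sub (hfm t k hk)
  have hem : ∀ t, ∀ k < t, Measurable[𝓜 t] (e k) := fun t k hk =>
    ((measurable_reward_history hk).mono (hhist t) le_rfl).sub (hfm t k hk.le)
  have hN : (0 : ℝ) < 𝒢.card := by exact_mod_cast h𝒢.card_pos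
  have htail : ∀ g ∈ 𝒢, μ.real {ω | Real.log (𝒢.card / δ) ≤
      ∑ k ∈ Finset.range t, (d g k ω * e k ω / 2 - d g k ω ^ 2 / 8)} ≤ δ / 𝒢.card := by
    intro g hg
    have := measureReal_log_le_sum_le (μ := μ) h𝓜le (hdm g) hem
      (fun t ω => hC g hg (θ ω) (act t ω)) hint.noise_bounded hint.noise_centered t
      (L := 𝒢.card / δ) (by positivity)
    rwa [one_div_div] at this
  have hsub : ({ω | ¬ InConfidence 𝒢 β t (fun k => act k ω) (fun k => R k ω) (f (θ ω))} : Set Ω)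
      ≤ᵐ[μ] (⋃ g ∈ 𝒢, {ω | Real.log (𝒢.card / δ) ≤
        ∑ k ∈ Finset.range t, (d g k ω * e k ω / 2 - d g k ω ^ 2 / 8)} : Set Ω) := by
    filter_upwards [ae_all_iff.2 hint.noise_bounded] with ω hω hbad
    by_contra hgood
    replace hgood : ω ∉ ⋃ g ∈ 𝒢, {ω | Real.log (𝒢.card / δ) ≤
        ∑ k ∈ Finset.range t, (d g k ω * e k ω / 2 - d g k ω ^ 2 / 8)} := hgood
    simp only [Set.mem_iUnion, Set.mem_ofPred_eq, exists_prop, not_exists, not_and,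
      not_le] at hgood
    exact hbad (inConfidence_of_sum_lt hα (fun g hg s => hC g hg _ s) hω (hcov _)
      (fun g hg => (hgood g hg).le) hβ)
  calc μ.real {ω | ¬ InConfidence 𝒢 β t (fun k => act k ω) (fun k => R k ω) (f (θ ω))}
      ≤ μ.real (⋃ g ∈ 𝒢, {ω | Real.log (𝒢.card / δ) ≤
        ∑ k ∈ Finset.range t, (d g k ω * e k ω / 2 - d g k ω ^ 2 / 8)}) :=
        ENNReal.toReal_mono (measure_ne_top _ _) (measure_mono_ae hsub)
    _ ≤ ∑ g ∈ 𝒢, δ / 𝒢.card :=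
        (measureReal_biUnion_finset_le _ _).trans (Finset.sum_le_sum htail)
    _ = δ := by
        rw [Finset.sum_const, nsmul_eq_mul]
        field_simp

end Interaction

/-! ### The Bayesian regret of Thompson sampling -/

section Regret

variable {S Θ Ω : Type*} [Fintype S]

theorem exists_finset_cover {F : Set (S → ℝ)} {C α₀ : ℝ} (hα₀ : 0 < α₀)
    (hF : ∀ f ∈ F, ∀ s, f s ∈ Set.Icc 0 C) :
    ∃ 𝒢 : Finset (S → ℝ), (∀ g ∈ 𝒢, g ∈ F) ∧ 𝒢.card = supCoveringNumber F α₀ ∧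
      ∀ f ∈ F, ∃ g ∈ 𝒢, ∀ s, |g s - f s| ≤ α₀ := by
  obtain ⟨G, hGF, hfin, hcov, hcard⟩ :=
    Metric.exists_set_encard_eq_coveringNumber (coveringNumber_ne_top hα₀ hF)
  refine ⟨hfin.toFinset, fun g hg => hGF (hfin.mem_toFinset.1 hg), ?_, fun f hf => ?_⟩
  · rw [supCoveringNumber, ← hcard, hfin.encard_eq_coe_toFinset_card]
    rfl
  · obtain ⟨g, hg, hfg⟩ := hcov hf
    refine ⟨g, hfin.mem_toFinset.2 hg, fun s => ?_⟩
    change edist f g ≤ ((α₀.toNNReal : NNReal) : ENNReal) at hfg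
    rw [edist_dist] at hfg
    have h1 : dist f g ≤ α₀ := (ENNReal.ofReal_le_ofReal_iff hα₀.le).1 hfg
    have h2 := (dist_le_pi_dist f g s).trans h1
    rwa [dist_comm, Real.dist_eq] at h2

theorem log_two_mul_sq_div_bounds {T : ℕ} (hT : 1 ≤ T) {δ : ℝ} (hδ₀ : 0 < δ)
    (hδ : δ ≤ 1 / (2 * (T : ℝ))) : 0 ≤ Real.log (2 * (T : ℝ) ^ 2 / δ) ∧
      (2 ≤ T → 2 ≤ Real.log (2 * (T : ℝ) ^ 2 / δ)) := by
  have hT1 : (1 : ℝ) ≤ T := by exact_mod_cast hT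
  have hδ' : δ * (2 * T) ≤ 1 := by rwa [le_div_iff₀ (by positivity)] at hδ
  have h1 : 4 * (T : ℝ) ^ 3 ≤ 2 * (T : ℝ) ^ 2 / δ := by
    rw [le_div_iff₀ hδ₀]
    nlinarith [sq_nonneg (T : ℝ)]
  constructor
  · refine Real.log_nonneg (le_trans ?_ h1)
    have := one_le_pow₀ hT1 (n := 3)
    linarith
  · intro hT2
    have hT2 : (2 : ℝ) ≤ T := by exact_mod_cast hT2
    have h2 : (2 : ℝ) ^ 5 ≤ 2 * (T : ℝ) ^ 2 / δ := by
      have := pow_le_pow_left₀ (by norm_num) hT2 3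
      linarith
    have h3 := Real.log_le_log (by norm_num) h2
    rw [Real.log_pow] at h3
    have := Real.log_two_gt_d9
    push_cast at h3
    linarith

/-- With at most `T - 1` past rounds, `confWidth` covers the radius of the least-squares confidence
set. For `T = 1` there is no past, and for `T ≥ 2` the logarithm is at least `2`. -/
theorem radius_le_confWidth {F : Set (S → ℝ)} {C α₀ δ : ℝ} {t T : ℕ} (ht : t < T) (hC : 0 ≤ C)
    (hα₀ : 0 ≤ α₀) (hδ₀ : 0 < δ) (hδ : δ ≤ 1 / (2 * (T : ℝ))) :
    8 * Real.log (supCoveringNumber F α₀ / δ) + 2 * t * (α₀ * C + 2 * α₀)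
      ≤ confWidth F C α₀ δ T := by
  obtain ⟨h0, h2⟩ := log_two_mul_sq_div_bounds (by omega) hδ₀ hδ
  have hkey : (t : ℝ) * (C + 2) ≤ T * (15 / 2 * C + Real.log (2 * (T : ℝ) ^ 2 / δ)) := by
    rcases Nat.eq_zero_or_pos t with rfl | hpos
    · simp only [Nat.cast_zero, zero_mul]
      positivity
    · have := h2 (by omega)
      have : (t : ℝ) ≤ T := by exact_mod_cast ht.le
      gcongr
      linarith
  have := mul_le_mul_of_nonneg_left hkey (by positivity : 0 ≤ 2 * α₀)
  rw [confWidth]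
  linarith

variable [MeasurableSpace Θ] [mΩ : MeasurableSpace Ω] {μ : Measure Ω} [IsProbabilityMeasure μ]
  {f : Θ → S → ℝ} {θ : Ω → Θ} {avail : ℕ → Ω → Finset S} {act : ℕ → Ω → S} {R : ℕ → Ω → ℝ}
  {θhat : ℕ → Ω → Θ}

/-- Probability matching: as the presented set is known, the best value under `θ` has the mean of
the best value under the sample `θhat t`, and the latter is attained by the chosen action. -/
theorem integral_regret_le (hf : ∀ s, Measurable fun ϑ => f ϑ s) {C : ℝ}
    (hC : ∀ ϑ s, f ϑ s ∈ Set.Icc 0 C) (hint : IsInteraction μ f θ avail act R)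
    (hTS : IsThompsonSampling μ f θ avail act R θhat) (t : ℕ) :
    ∫ ω, ((⨆ s : {s // s ∈ avail t ω}, f (θ ω) s) - f (θ ω) (act t ω)) ∂μ
      ≤ ∫ ω, (f (θhat t ω) (act t ω) - f (θ ω) (act t ω)) ∂μ := by
  let _ : MeasurableSpace (Finset S) := ⊤
  have hbest : ∀ A : Finset S, Measurable fun ϑ => ⨆ s : {s // s ∈ A}, f ϑ s := fun A =>
    Measurable.iSup fun s => hf s
  have hbestm : ∀ ϑ : Ω → Θ, Measurable ϑ →
      Measurable fun ω => ⨆ s : {s // s ∈ avail t ω}, f (ϑ ω) s := fun ϑ hϑ =>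
    measurable_apply_of_countable (F := fun (A : Finset S) ϑ => ⨆ s : {s // s ∈ A}, f ϑ s) hbest
      (hint.measurable_avail t) hϑ
  have hactm : ∀ ϑ : Ω → Θ, Measurable ϑ → Measurable fun ω => f (ϑ ω) (act t ω) := fun ϑ hϑ =>
    measurable_apply_of_countable (F := fun s ϑ => f ϑ s) hf (hint.measurable_act t) hϑ
  have hbestint : ∀ ϑ : Ω → Θ, Measurable ϑ →
      Integrable (fun ω => ⨆ s : {s // s ∈ avail t ω}, f (ϑ ω) s) μ := by
    intro ϑ hϑ
    refine Integrable.of_bound (hbestm ϑ hϑ).aestronglyMeasurable C (ae_of_all _ fun ω => ?_)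
    have : Nonempty {s // s ∈ avail t ω} := (hint.avail_nonempty t ω).to_subtype
    rw [Real.norm_of_nonneg (Real.iSup_nonneg fun s => (hC _ _).1)]
    exact ciSup_le fun s => (hC _ _).2
  have hactint : ∀ ϑ : Ω → Θ, Measurable ϑ → Integrable (fun ω => f (ϑ ω) (act t ω)) μ := by
    intro ϑ hϑ
    refine Integrable.of_bound (hactm ϑ hϑ).aestronglyMeasurable C (ae_of_all _ fun ω => ?_)
    rw [Real.norm_of_nonneg (hC _ _).1]
    exact (hC _ _).2
  have hθ := hint.measurable_param
  have hθhat := hTS.measurable_sample t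
  rw [integral_sub (hbestint θ hθ) (hactint θ hθ), integral_sub (hactint _ hθhat) (hactint θ hθ)]
  have hmatch := integral_eq_of_condExp_eq (μ := μ) (m := history avail act R t)
    (m' := history avail act R t ⊔ MeasurableSpace.comap θ inferInstance) le_sup_left
    (sup_le (hint.history_le t) hθ.comap_le) (measurable_avail_history t) hθhat hθ
    (hTS.posterior_sample t) (φ := fun p : Finset S × Θ => ⨆ s : {s // s ∈ p.1}, f p.2 s)
    (measurable_from_prod_countable_right hbest)
  simp only at hmatch
  rw [← hmatch]
  refine sub_le_sub_right (integral_mono (hbestint _ hθhat) (hactint _ hθhat) fun ω => ?_) _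
  have : Nonempty {s // s ∈ avail t ω} := (hint.avail_nonempty t ω).to_subtype
  exact ciSup_le fun s => hTS.act_optimal t ω s s.2

/-- The sampled function leaves the confidence set, which is determined by the history, with the
same probability as the true one. -/
theorem measureReal_sample_not_inConfidence_eq (hf : ∀ s, Measurable fun ϑ => f ϑ s)
    (hint : IsInteraction μ f θ avail act R)
    (hTS : IsThompsonSampling μ f θ avail act R θhat) (𝒢 : Finset (S → ℝ)) (β : ℝ) (t : ℕ) :
    μ.real {ω | ¬ InConfidence 𝒢 β t (fun k => act k ω) (fun k => R k ω) (f (θhat t ω))}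
      = μ.real {ω | ¬ InConfidence 𝒢 β t (fun k => act k ω) (fun k => R k ω) (f (θ ω))} := by
  have hfst : @Measurable (Ω × Θ) Ω ((history avail act R t).prod inferInstance)
      (history avail act R t) Prod.fst := @measurable_fst _ _ (history avail act R t) _
  have hsnd : @Measurable (Ω × Θ) Θ ((history avail act R t).prod inferInstance)
      inferInstance Prod.snd := @measurable_snd _ _ (history avail act R t) _
  have hE := measurableSet_inConfidence (m := (history avail act R t).prod inferInstance)
    hf 𝒢 β (t := t) (a := fun k (p : Ω × Θ) => act k p.1) (r := fun k p => R k p.1)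
    (h := Prod.snd) (fun k hk => (measurable_act_history hk).comp hfst)
    (fun k hk => (measurable_reward_history hk).comp hfst) hsnd
  exact measureReal_eq_of_condExp_eq (μ := μ) (X := Ω) (mX := history avail act R t) (H := id)
    (m := history avail act R t)
    (m' := history avail act R t ⊔ MeasurableSpace.comap θ inferInstance) le_sup_left
    (sup_le (hint.history_le t) hint.measurable_param.comap_le)
    (@measurable_id Ω (history avail act R t)) (hTS.measurable_sample t) hint.measurable_param
    (hTS.posterior_sample t) hE.compl

/-- The regret bound for a general finite set of actions. -/
theorem bayesRegret_le (hf : ∀ s, Measurable fun ϑ => f ϑ s) {C : ℝ}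
    (hC : ∀ ϑ s, f ϑ s ∈ Set.Icc 0 C) (hint : IsInteraction μ f θ avail act R)
    (hTS : IsThompsonSampling μ f θ avail act R θhat) {T : ℕ} (hT : 1 ≤ T) {α₀ : ℝ}
    (hα₀ : 0 < α₀) {δ : ℝ} (hδ₀ : 0 < δ) (hδ : δ ≤ 1 / (2 * (T : ℝ))) :
    bayesRegret μ f θ avail act T ≤
      4 * √(((eluderDim (Set.range f) (1 / (T : ℝ))).toNat : ℝ)
            * confWidth (Set.range f) C α₀ δ T * T)
        + 1 + (((eluderDim (Set.range f) (1 / (T : ℝ))).toNat : ℝ) + 1) * C := by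
  classical
  obtain ⟨ω₀⟩ : Nonempty Ω := μ.nonempty_of_neZero
  have hC0 : 0 ≤ C := (hC (θ ω₀) (act 0 ω₀)).1.trans (hC (θ ω₀) (act 0 ω₀)).2
  have hF : ∀ h ∈ Set.range f, ∀ s, h s ∈ Set.Icc 0 C := by
    rintro _ ⟨ϑ, rfl⟩
    exact hC ϑ
  have hdiff : ∀ ϑ ϑ' s, |f ϑ s - f ϑ' s| ≤ C := fun ϑ ϑ' s =>
    abs_le.2 ⟨by linarith [(hC ϑ s).1, (hC ϑ' s).2], by linarith [(hC ϑ s).2, (hC ϑ' s).1]⟩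
  obtain ⟨𝒢, h𝒢F, hcard, hcov⟩ := exists_finset_cover hα₀ hF
  have h𝒢 : 𝒢.Nonempty := by
    obtain ⟨g, hg, -⟩ := hcov (f (θ ω₀)) ⟨_, rfl⟩
    exact ⟨g, hg⟩
  set β := confWidth (Set.range f) C α₀ δ T
  set d := (eluderDim (Set.range f) (1 / (T : ℝ))).toNat
  have hT1 : (1 : ℝ) ≤ T := by exact_mod_cast hT
  have hβ : 0 ≤ β := by
    have h0 := radius_le_confWidth (F := Set.range f) (t := 0) hT hC0 hα₀.le hδ₀ hδ
    refine le_trans ?_ h0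
    have hN : (1 : ℝ) ≤ supCoveringNumber (Set.range f) α₀ := by
      rw [← hcard]
      exact_mod_cast h𝒢.card_pos
    have hδ1 : δ ≤ 1 := hδ.trans (by rw [div_le_one (by positivity)]; linarith)
    have := Real.log_nonneg ((one_le_div hδ₀).2 (hδ1.trans hN))
    simp only [Nat.cast_zero, mul_zero, zero_mul, add_zero]
    positivity
  set bad : ℕ → (Ω → Θ) → Set Ω := fun t ϑ =>
    {ω | ¬ InConfidence 𝒢 β t (fun k => act k ω) (fun k => R k ω) (f (ϑ ω))} with hbad
  have hbadm : ∀ t ϑ, Measurable ϑ → MeasurableSet (bad t ϑ) := fun t ϑ hϑ =>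
    (measurableSet_inConfidence hf 𝒢 β (fun k _ => hint.measurable_act k)
      (fun k _ => hint.measurable_reward k) hϑ).compl
  have hprob : ∀ t < T, μ.real (bad t θ) ≤ δ := fun t ht =>
    hint.measureReal_not_inConfidence_le hf h𝒢 (C := C) hα₀.le hδ₀
      (fun g hg ϑ s => by
        obtain ⟨ϑ', rfl⟩ := h𝒢F g hg
        exact hdiff ϑ' ϑ s)
      (fun ϑ => hcov _ ⟨ϑ, rfl⟩)
      (by rw [hcard]; exact radius_le_confWidth ht hC0 hα₀.le hδ₀ hδ)
  have hprob' : ∀ t < T, μ.real (bad t (θhat t)) ≤ δ := fun t ht =>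
    (measureReal_sample_not_inConfidence_eq hf hint hTS 𝒢 β t).trans_le (hprob t ht)
  set ind : ℕ → Ω → ℝ := fun t ω =>
    (bad t θ).indicator (fun _ => C) ω + (bad t (θhat t)).indicator (fun _ => C) ω with hind
  have hind0 : ∀ t ω, 0 ≤ ind t ω := fun t ω =>
    add_nonneg (Set.indicator_nonneg (fun _ _ => hC0) ω) (Set.indicator_nonneg (fun _ _ => hC0) ω)
  set B := 1 + d * C + 4 * √(d * β * T) with hB
  -- rounds in which both functions lie in the confidence set are paid for by the margin
  -- dimension, the others by the indicators of failure
  have hpath : ∀ ω, ∑ t ∈ Finset.range T, (f (θhat t ω) (act t ω) - f (θ ω) (act t ω))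
      ≤ B + ∑ t ∈ Finset.range T, ind t ω := by
    intro ω
    rw [← Finset.sum_filter_add_sum_filter_not (Finset.range T)
      (fun t => ω ∉ bad t θ ∧ ω ∉ bad t (θhat t))]
    refine add_le_add ?_ ?_
    · refine (Finset.sum_le_sum fun t _ => le_abs_self _).trans ?_
      refine sum_width_le hβ hT hF hC0 (fun k => act k ω) (fun t => f (θhat t ω))
        (fun _ => f (θ ω)) _ (Finset.filter_subset _ _) (fun t _ => ⟨_, rfl⟩)
        (fun t _ => ⟨_, rfl⟩) fun t ht => ?_
      obtain ⟨h1, h2⟩ := (Finset.mem_filter.1 ht).2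
      exact InConfidence.sum_sq_sub_le h𝒢 (not_not.1 h2) (not_not.1 h1)
    · refine le_trans (Finset.sum_le_sum (g := fun t => ind t ω) fun t ht => ?_)
        (Finset.sum_le_sum_of_subset_of_nonneg (Finset.filter_subset _ _) fun t _ _ => hind0 t ω)
      have hb := (Finset.mem_filter.1 ht).2
      refine ((le_abs_self _).trans (hdiff _ _ _)).trans ?_
      rw [not_and_or, not_not, not_not] at hb
      rcases hb with hb | hb
      · have := Set.indicator_nonneg (s := bad t (θhat t)) (f := fun _ => C) (fun _ _ => hC0) ω
        simp only [hind, Set.indicator_of_mem hb]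
        linarith
      · have := Set.indicator_nonneg (s := bad t θ) (f := fun _ => C) (fun _ _ => hC0) ω
        simp only [hind, Set.indicator_of_mem hb]
        linarith
  have hgapint : ∀ t, Integrable (fun ω => f (θhat t ω) (act t ω) - f (θ ω) (act t ω)) μ := by
    intro t
    have hm : ∀ ϑ : Ω → Θ, Measurable ϑ → Measurable fun ω => f (ϑ ω) (act t ω) := fun ϑ hϑ =>
      measurable_apply_of_countable (F := fun s ϑ => f ϑ s) hf (hint.measurable_act t) hϑ
    exact Integrable.of_bound ((hm _ (hTS.measurable_sample t)).sub
      (hm _ hint.measurable_param)).aestronglyMeasurable C (ae_of_all _ fun ω => hdiff _ _ _)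
  have hconst : ∀ t ϑ, Measurable ϑ → Integrable ((bad t ϑ).indicator fun _ => C) μ :=
    fun t ϑ hϑ => (integrable_const C).indicator (hbadm t ϑ hϑ)
  have hindint : ∀ t, Integrable (ind t) μ := fun t =>
    (hconst t θ hint.measurable_param).add (hconst t _ (hTS.measurable_sample t))
  have hindle : ∀ t < T, ∫ ω, ind t ω ∂μ ≤ 2 * δ * C := by
    intro t ht
    rw [integral_add (hconst t θ hint.measurable_param) (hconst t _ (hTS.measurable_sample t)),
      integral_indicator_const C (hbadm t _ hint.measurable_param),
      integral_indicator_const C (hbadm t _ (hTS.measurable_sample t)), smul_eq_mul, smul_eq_mul]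
    have := mul_le_mul_of_nonneg_right (hprob t ht) hC0
    have := mul_le_mul_of_nonneg_right (hprob' t ht) hC0
    linarith
  have hfail : ∑ t ∈ Finset.range T, ∫ ω, ind t ω ∂μ ≤ C := by
    have h1 := Finset.sum_le_card_nsmul (Finset.range T) (fun t => ∫ ω, ind t ω ∂μ) (2 * δ * C)
      fun t ht => hindle t (Finset.mem_range.1 ht)
    rw [Finset.card_range, nsmul_eq_mul] at h1
    rw [le_div_iff₀ (by positivity)] at hδ
    have := mul_le_mul_of_nonneg_right hδ hC0
    linarith
  calc bayesRegret μ f θ avail act T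
      ≤ ∑ t ∈ Finset.range T, ∫ ω, (f (θhat t ω) (act t ω) - f (θ ω) (act t ω)) ∂μ :=
        Finset.sum_le_sum fun t _ => integral_regret_le hf hC hint hTS t
    _ = ∫ ω, ∑ t ∈ Finset.range T, (f (θhat t ω) (act t ω) - f (θ ω) (act t ω)) ∂μ :=
        (integral_finsetSum _ fun t _ => hgapint t).symm
    _ ≤ ∫ ω, (B + ∑ t ∈ Finset.range T, ind t ω) ∂μ :=
        integral_mono (integrable_finsetSum _ fun t _ => hgapint t)
          ((integrable_const B).add (integrable_finsetSum _ fun t _ => hindint t)) hpath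
    _ = B + ∑ t ∈ Finset.range T, ∫ ω, ind t ω ∂μ := by
        rw [integral_add (integrable_const B) (integrable_finsetSum _ fun t _ => hindint t),
          integral_finsetSum _ fun t _ => hindint t]
        simp
    _ ≤ _ := by
        rw [hB]
        linarith

end Regret

end SuperArmBandit

theorem lemma1 {Arm : Type*} (𝒮 : Finset (Finset Arm))
    {Θ Ω : Type*} [MeasurableSpace Θ] [MeasurableSpace Ω]
    (μ : Measure Ω) [IsProbabilityMeasure μ]
    (f : Θ → 𝒮 → ℝ) (hf : ∀ s, Measurable fun ϑ => f ϑ s)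
    (C : ℝ) (hC : ∀ ϑ s, f ϑ s ∈ Set.Icc 0 C)
    (θ : Ω → Θ) (avail : ℕ → Ω → Finset 𝒮) (act : ℕ → Ω → 𝒮) (R : ℕ → Ω → ℝ)
    (θhat : ℕ → Ω → Θ)
    (hint : SuperArmBandit.IsInteraction μ f θ avail act R)
    (hTS : SuperArmBandit.IsThompsonSampling μ f θ avail act R θhat)
    (T : ℕ) (hT : 1 ≤ T) (α₀ : ℝ) (hα₀ : 0 < α₀)
    (δ : ℝ) (hδ₀ : 0 < δ) (hδ : δ ≤ 1 / (2 * (T : ℝ))) :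
    SuperArmBandit.bayesRegret μ f θ avail act T ≤
      4 * √(((SuperArmBandit.eluderDim (Set.range f) (1 / (T : ℝ))).toNat : ℝ)
            * SuperArmBandit.confWidth (Set.range f) C α₀ δ T * T)
        + 1
        + (((SuperArmBandit.eluderDim (Set.range f) (1 / (T : ℝ))).toNat : ℝ) + 1) * C := by
  exact SuperArmBandit.bayesRegret_le hf hC hint hTS hT hα₀ hδ₀ hδ
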